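/- **Conventions.** Let $n\ge 5$. A *generalized $n$-manifold* is an $n$-dimensional metrizable absolute neighbourhood retract $X$ such that $H_*(X,X\setminus\{x\};\mathbb Z)\cong H_*(\mathbb R^n,\mathbb R^n\setminus\{0\};\mathbb Z)$ for every $x\in X$; it is *orientable* if generators of the groups $H_n(X,X\setminus\{x\};\mathbb Z)\cong\mathbb Z$ can be chosen in a locally consistent way. A *$\delta$-map* $f\colon X\to Y$ is a continuous map of a metric space $X$ onto a topological space $Y$ such that $\operatorname{diam} f^{-1}(y)<\delta$ for every $y\in Y$. A compact metric space $X$ is *$n$-manifold-like* if for every $\delta>0$ there is a $\delta$-map of $X$ onto some closed orientable topological $n$-manifold. **Theorem (Approximation Theorem).** Let $X$ be a nonempty compact orientable generalized $n$-manifold that is $n$-manifold-like, with the metric induced by an embedding $X\hookrightarrow\mathbb R^m$. Then for every $\delta>0$ there is a closed orientable topological $n$-manifold $M_\delta$, equipped with a metric inducing its topology, such that $X$ admits a $\delta$-map onto $M_\delta$ and the Gromov–Hausdorff distance satisfies $$d_G(X,M_\delta)<\delta .$$ Moreover, if $m\ge 2n+1$, then the metric of $M_\delta$ can be taken to be induced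 by an embedding of $M_\delta$ into $\mathbb R^m$ whose image lies in the open $\delta$-neighbourhood of $X$ in $\mathbb R^m$. -/

import Mathlib

open CategoryTheory

noncomputable section

/-- The inclusion of a subspace, as a morphism of `TopCat`. -/
def subspaceIncl (X : Type) [TopologicalSpace X] (A : Set X) : TopCat.of A ⟶ TopCat.of X :=
  TopCat.ofHom ⟨Subtype.val, continuous_subtype_val⟩

/-- The inclusion `A → B` of subspaces of `X` when `A ⊆ B`, as a morphism of `TopCat`. -/
def subspaceInclOfSubset (X : Type) [TopologicalSpace X] {A B : Set X} (h : A ⊆ B) :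
    TopCat.of A ⟶ TopCat.of B :=
  TopCat.ofHom ⟨Set.inclusion h, continuous_inclusion h⟩

/-- The integral singular chain complex functor `C_*(-; ℤ)`. -/
def singChains : TopCat.{0} ⥤ ChainComplex (ModuleCat.{0} ℤ) ℕ :=
  (AlgebraicTopology.singularChainComplexFunctor (ModuleCat.{0} ℤ)).obj (ModuleCat.of ℤ ℤ)

/-- The relative singular chain complex `C_*(X, A; ℤ) = C_*(X; ℤ) / C_*(A; ℤ)`. -/
def relChains (X : Type) [TopologicalSpace X] (A : Set X) :
    ChainComplex (ModuleCat.{0} ℤ) ℕ :=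
  Limits.cokernel (singChains.map (subspaceIncl X A))

/-- The map `C_*(X, A; ℤ) → C_*(X, B; ℤ)` induced by the identity of `X`, for `A ⊆ B`. -/
def relChainsMap (X : Type) [TopologicalSpace X] {A B : Set X} (h : A ⊆ B) :
    relChains X A ⟶ relChains X B :=
  Limits.cokernel.map _ _ (singChains.map (subspaceInclOfSubset X h)) (𝟙 _) (by
    rw [Category.comp_id, ← Functor.map_comp]
    rfl)

/-- Relative singular homology `H_k(X, A; ℤ)`. -/
def relHomology (X : Type) [TopologicalSpace X] (A : Set X) (k : ℕ) : ModuleCat.{0} ℤ :=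
  (relChains X A).homology k

/-- The restriction `H_k(X, A; ℤ) → H_k(X, B; ℤ)` for `A ⊆ B`. -/
def relHomologyMap (X : Type) [TopologicalSpace X] {A B : Set X} (h : A ⊆ B) (k : ℕ) :
    relHomology X A k ⟶ relHomology X B k :=
  HomologicalComplex.homologyMap (relChainsMap X h) k

/-- Every point `x` of `X` has local homology
`H_*(X, X ∖ {x}; ℤ) ≅ H_*(ℝⁿ, ℝⁿ ∖ {0}; ℤ)`, in every degree. -/
def HasEuclideanLocalHomology (n : ℕ) (X : Type) [TopologicalSpace X] : Prop :=
  ∀ (x : X) (k : ℕ), Nonempty (relHomology X {x}ᶜ k ≅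
    relHomology (EuclideanSpace ℝ (Fin n)) {(0 : EuclideanSpace ℝ (Fin n))}ᶜ k)

/-- Orientability of an (integral homology) `n`-manifold: there is a choice of generators
`μ x` of the local homology groups `H_n(X, X ∖ {x}; ℤ)` that is locally consistent, i.e. near
every point the generators `μ y` are the restrictions of one class in `H_n(X, X ∖ U; ℤ)`, for
some open neighbourhood `U` of the point. -/
def IsOrientable (n : ℕ) (X : Type) [TopologicalSpace X] : Prop :=
  ∃ μ : ∀ x : X, relHomology X {x}ᶜ n,
    (∀ x, Submodule.span ℤ {μ x} = ⊤) ∧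
    ∀ x, ∃ U : Set X, IsOpen U ∧ x ∈ U ∧ ∃ c : relHomology X Uᶜ n,
      ∀ (y : X) (hy : y ∈ U),
        relHomologyMap X (Set.compl_subset_compl.2 (Set.singleton_subset_iff.2 hy)) n c = μ y

/-- Absolute neighbourhood retracts (for metrizable spaces): whenever `X` is embedded as a closed
subspace of a metrizable space `Y`, some open neighbourhood of `X` in `Y` retracts onto `X`. -/
def IsANR (X : Type) [TopologicalSpace X] : Prop :=
  TopologicalSpace.MetrizableSpace X ∧
  ∀ (Y : Type) [TopologicalSpace Y] [TopologicalSpace.MetrizableSpace Y] (e : X → Y),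
    Topology.IsClosedEmbedding e →
    ∃ (U : Set Y) (hU : Set.range e ⊆ U) (r : C(U, X)),
      IsOpen U ∧ ∀ x, r ⟨e x, hU ⟨x, rfl⟩⟩ = x

/-- Orientable generalized `n`-manifolds (without boundary): `n`-dimensional metrizable absolute
neighbourhood retracts with the local homology of `ℝⁿ` at every point, which are orientable.
(For separable metrizable spaces all the usual notions of topological dimension agree.) -/
structure IsOrientableGeneralizedManifold (n : ℕ) (X : Type) [TopologicalSpace X] : Prop where
  isANR : IsANR X
  dim_eq : smallInductiveDimension X = n
  localHomology : HasEuclideanLocalHomology n X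
  orientable : IsOrientable n X

/-- Closed topological `n`-manifolds: compact Hausdorff spaces that are locally homeomorphic to
`ℝⁿ` (second countability follows from compactness). -/
structure IsClosedTopManifold (n : ℕ) (M : Type) [TopologicalSpace M] : Prop where
  compact : CompactSpace M
  t2 : T2Space M
  charted : Nonempty (ChartedSpace (EuclideanSpace ℝ (Fin n)) M)

/-- A `δ`-map: a continuous map of a metric space onto a topological space all of whose point
preimages have diameter `< δ`. -/
structure IsDeltaMap {X Y : Type} [MetricSpace X] [TopologicalSpace Y] (δ : ℝ) (f : X → Y) :
    Prop where
  continuous : Continuous f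
  surjective : Function.Surjective f
  ediam_lt : ∀ y, Metric.ediam (f ⁻¹' {y}) < ENNReal.ofReal δ

/-- `X` is `n`-manifold-like: for every `δ > 0` it admits a `δ`-map (structure map) onto some
closed orientable topological `n`-manifold. -/
def IsManifoldLike (n : ℕ) (X : Type) [MetricSpace X] : Prop :=
  ∀ δ : ℝ, 0 < δ → ∃ (M : Type) (_ : TopologicalSpace M),
    IsClosedTopManifold n M ∧ IsOrientable n M ∧ ∃ f : X → M, IsDeltaMap δ f

end

/-! A `δ/3`-map `f : X → M` has an approximate inverse. Its fibres are small, so a partition of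
unity on `M` averages points of `X` into a map `g : M → F` with `g ∘ f` within `δ/3` of the given
embedding `i`. If `dim F ≥ 2n + 1`, a further move of less than `δ/3` makes `g` an embedding `j`,
and `M` takes its metric from `j`. As `f` is onto, each point of either image lies within `2δ/3` of
the other image.

The embedding comes from Baire category in `C(M, F)`: injectivity follows from countably many open
dense conditions, each separating the images of two disjoint closed sets lying in charts. For
density, make the map `C¹` near both sets and translate one image by a small generic vector. -/

open Set Topology Filter Metric Module in
/-- On a compact subset of a chart domain, a continuous map can be made `C¹` in the coordinates of
the chart, by a small change supported in the chart domain. -/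
lemma exists_approx_contDiff_in_chart {M E F : Type*} [TopologicalSpace M] [CompactSpace M]
    [T2Space M] [NormedAddCommGroup E] [NormedSpace ℝ E] [FiniteDimensional ℝ E]
    [NormedAddCommGroup F] [NormedSpace ℝ F]
    (φ : OpenPartialHomeomorph M E) (g : C(M, F)) {K W : Set M} (hK : IsClosed K)
    (hW : IsOpen W) (hKW : K ⊆ W) (hWφ : W ⊆ φ.source) {ε : ℝ} (hε : 0 < ε) :
    ∃ (g' : C(M, F)) (p : E → F), ContDiff ℝ 1 p ∧ (∀ y, dist (g' y) (g y) < ε) ∧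
      (∀ y ∉ W, g' y = g y) ∧ ∀ y ∈ K, g' y = p (φ y) := by
  obtain ⟨χ, hχW, hχK, hχ⟩ :=
    exists_tsupport_one_of_isOpen_isClosed hW isClosed_closure.isCompact hK hKW
  have hNφ : tsupport χ ⊆ φ.source := hχW.trans hWφ
  have hN : IsCompact (tsupport χ) := (isClosed_tsupport _).isCompact
  have hNc : IsClosed (φ '' tsupport χ) :=
    (hN.image_of_continuousOn (φ.continuousOn.mono hNφ)).isClosed
  obtain ⟨p, hp⟩ := exists_contMDiffMap_forall_mem_convex_of_local_const (n := 1)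
    (modelWithCornersSelf ℝ E)
    -- No constraint is imposed off the compact set `φ '' tsupport χ`, so `p` can be defined on all
    -- of `E`.
    (t := fun x => {v : F | x ∈ φ '' tsupport χ → v ∈ ball (g (φ.symm x)) ε})
    (fun x => by
      by_cases hx : x ∈ φ '' tsupport χ
      · simpa only [hx, true_imp_iff, ofPred_mem_eq] using convex_ball _ _
      · simpa only [hx, false_imp_iff, ofPred_true] using convex_univ)
    (fun x => by
      by_cases hx : x ∈ φ '' tsupport χ
      · refine ⟨g (φ.symm x), ?_⟩
        have hxt : x ∈ φ.target := by
          obtain ⟨y, hy, rfl⟩ := hx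
          exact φ.map_source (hNφ hy)
        have hc : ContinuousAt (fun z => g (φ.symm z)) x :=
          g.continuous.continuousAt.comp (φ.continuousAt_symm hxt)
        filter_upwards [hc (ball_mem_nhds _ hε)] with z hz _
        exact mem_ball_comm.1 hz
      · refine ⟨0, ?_⟩
        filter_upwards [hNc.isOpen_compl.mem_nhds hx] with z hz hz'
        exact absurd hz' hz)
  have hp' : ∀ y ∈ tsupport χ, dist (p (φ y)) (g y) < ε := fun y hy => by
    simpa [φ.left_inv (hNφ hy)] using hp (φ y) (mem_image_of_mem _ hy)
  have hcont : Continuous fun y => χ y • (p (φ y) - g y) := by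
    refine continuous_of_tsupport fun y hy => ?_
    have hy' : y ∈ tsupport χ := tsupport_smul_subset_left _ _ hy
    exact χ.continuous.continuousAt.smul
      ((p.contMDiff.continuous.continuousAt.comp (φ.continuousAt (hNφ hy'))).sub
        g.continuous.continuousAt)
  refine ⟨g + ⟨_, hcont⟩, p, p.contMDiff.contDiff, fun y => ?_, fun y hy => ?_, fun y hy => ?_⟩
  · by_cases hy : y ∈ tsupport χ
    · have h := hp' y hy
      rw [dist_eq_norm] at h
      simp only [ContinuousMap.add_apply, ContinuousMap.coe_mk, dist_self_add_left, norm_smul,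
        Real.norm_of_nonneg (hχ y).1]
      exact (mul_le_of_le_one_left (norm_nonneg _) (hχ y).2).trans_lt h
    · simp [image_eq_zero_of_notMem_tsupport hy, hε]
  · simp [image_eq_zero_of_notMem_tsupport fun h => hy (hχW h)]
  · simp [hχK hy]

open Set Topology Filter Metric Module in
/-- General position: the images of two disjoint closed sets, each contained in the domain of a
chart, can be made disjoint by a small perturbation when the target has dimension larger than the
sum of the dimensions of the charts. -/
lemma exists_approx_disjoint_image {M E E' F : Type*} [TopologicalSpace M] [CompactSpace M]
    [T2Space M] [NormedAddCommGroup E] [NormedSpace ℝ E] [FiniteDimensional ℝ E]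
    [NormedAddCommGroup E'] [NormedSpace ℝ E'] [FiniteDimensional ℝ E']
    [NormedAddCommGroup F] [NormedSpace ℝ F] [FiniteDimensional ℝ F]
    (hF : finrank ℝ E + finrank ℝ E' < finrank ℝ F)
    (φ : OpenPartialHomeomorph M E) (ψ : OpenPartialHomeomorph M E') {K L : Set M}
    (hK : IsClosed K) (hL : IsClosed L) (hKL : Disjoint K L) (hKφ : K ⊆ φ.source)
    (hLψ : L ⊆ ψ.source) (g : C(M, F)) {ε : ℝ} (hε : 0 < ε) :
    ∃ g' : C(M, F), (∀ y, dist (g' y) (g y) < ε) ∧ Disjoint (g' '' K) (g' '' L) := by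
  obtain ⟨U, V, hU, hV, hKU, hLV, hUV⟩ := normal_separation hK hL hKL
  obtain ⟨g₁, p, hp, hg₁, hg₁', hgp⟩ := exists_approx_contDiff_in_chart φ g hK
    (hU.inter φ.open_source) (subset_inter hKU hKφ) inter_subset_right (ε := ε / 3) (by positivity)
  obtain ⟨g₂, q, hq, hg₂, hg₂', hgq⟩ := exists_approx_contDiff_in_chart ψ g₁ hL
    (hV.inter ψ.open_source) (subset_inter hLV hLψ) inter_subset_right (ε := ε / 3) (by positivity)
  obtain ⟨χ, hχK, hχL, hχ⟩ := exists_continuous_zero_one_of_isClosed hK hL hKL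
  -- Translating the image of `L` by `v` creates a coincidence with that of `K` only if `v = p a - q
  -- b`; these differences form a `C¹` image of a space of too small dimension.
  have hd : Dense (range fun z : E × E' => p z.1 - q z.2)ᶜ := by
    refine ContDiff.dense_compl_range_of_finrank_lt_finrank
      ((hp.comp contDiff_fst).sub (hq.comp contDiff_snd)) ?_
    rwa [finrank_prod]
  obtain ⟨v, hv, hvε⟩ := hd.exists_dist_lt 0 (ε := ε / 3) (by positivity)
  rw [dist_zero_left] at hvε
  refine ⟨g₂ + ⟨fun y => χ y • v, by fun_prop⟩, fun y => ?_, ?_⟩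
  · have h₃ : dist (g₂ y + χ y • v) (g₂ y) < ε / 3 := by
      rw [dist_self_add_left, norm_smul, Real.norm_of_nonneg (hχ y).1]
      exact (mul_le_of_le_one_left (norm_nonneg _) (hχ y).2).trans_lt hvε
    have := dist_triangle4 (g₂ y + χ y • v) (g₂ y) (g₁ y) (g y)
    simp only [ContinuousMap.add_apply, ContinuousMap.coe_mk]
    linarith [hg₁ y, hg₂ y]
  · rw [Set.disjoint_left]
    rintro _ ⟨x, hx, rfl⟩ ⟨y, hy, hxy⟩
    refine hv ⟨(φ x, ψ y), ?_⟩
    -- The second smoothing is supported in `V`, hence leaves the first intact on `K`.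
    have hxV : x ∉ V ∩ ψ.source := fun h => Set.disjoint_left.1 hUV (hKU hx) h.1
    simp only [ContinuousMap.add_apply, ContinuousMap.coe_mk, hχK hx, hχL hy, hg₂' x hxV,
      hgp x hx, hgq y hy, Pi.zero_apply, Pi.one_apply, zero_smul, one_smul, add_zero] at hxy
    simp [← hxy]

open Set Topology Filter Metric Module in
/-- Continuous maps of a compact topological manifold of dimension `d` to a space of dimension at
least `2 * d + 1` can be approximated by embeddings. -/
lemma exists_approx_injective {M E F : Type*} [TopologicalSpace M] [CompactSpace M]
    [T2Space M] [NormedAddCommGroup E] [NormedSpace ℝ E] [FiniteDimensional ℝ E]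
    [ChartedSpace E M] [NormedAddCommGroup F] [NormedSpace ℝ F] [FiniteDimensional ℝ F]
    (hF : 2 * finrank ℝ E + 1 ≤ finrank ℝ F) (g : C(M, F)) {ε : ℝ} (hε : 0 < ε) :
    ∃ g' : C(M, F), (∀ y, dist (g' y) (g y) < ε) ∧ Function.Injective g' := by
  have : SecondCountableTopology M := ChartedSpace.secondCountable_of_sigmaCompact E M
  have : CompleteSpace F := FiniteDimensional.complete ℝ F
  let B := TopologicalSpace.countableBasis M
  have hB := TopologicalSpace.isBasis_countableBasis M
  let P : Set (Set M × Set M) := {p | p ∈ B ×ˢ B ∧ Disjoint (closure p.1) (closure p.2) ∧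
    ∃ x y : M, closure p.1 ⊆ (chartAt E x).source ∧ closure p.2 ⊆ (chartAt E y).source}
  have hP : P.Countable := ((TopologicalSpace.countable_countableBasis M).prod
    (TopologicalSpace.countable_countableBasis M)).mono fun _ h => h.1
  let G : Set M × Set M → Set C(M, F) :=
    fun p => {g | Disjoint (g '' closure p.1) (g '' closure p.2)}
  have hGo : ∀ p ∈ P, IsOpen (G p) := fun p _ => by
    have : G p = {g : C(M, F) | ∀ z ∈ closure p.1 ×ˢ closure p.2, g z.1 ≠ g z.2} := by
      ext g
      refine Set.disjoint_left.trans ⟨fun h z hz hzz => ?_, ?_⟩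
      · exact h (mem_image_of_mem g hz.1) (hzz ▸ mem_image_of_mem g hz.2)
      · rintro h _ ⟨x, hx, rfl⟩ ⟨y, hy, hxy⟩
        exact h (x, y) ⟨hx, hy⟩ hxy.symm
    rw [this]
    refine isOpen_iff_mem_nhds.2 fun g hg => ?_
    have hK : IsCompact (closure p.1 ×ˢ closure p.2) :=
      isClosed_closure.isCompact.prod isClosed_closure.isCompact
    -- Openness by the tube lemma, from joint continuity of evaluation.
    refine hK.eventually_forall_of_forall_eventually fun z hz => ?_
    have hc : Continuous fun w : C(M, F) × (M × M) => (w.1 w.2.1, w.1 w.2.2) := by fun_prop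
    have := (isClosed_diagonal (X := F)).isOpen_compl.preimage hc
    exact this.mem_nhds (x := (g, z)) (hg z hz)
  have hGd : ∀ p ∈ P, Dense (G p) := by
    rintro p ⟨-, hd, x, y, hx, hy⟩
    refine Metric.dense_iff.2 fun g r hr => ?_
    obtain ⟨g', hg', hdis⟩ := exists_approx_disjoint_image (F := F) (by omega) (chartAt E x)
      (chartAt E y) isClosed_closure isClosed_closure hd hx hy g hr
    exact ⟨g', mem_ball.2 ((ContinuousMap.dist_lt_iff hr).2 hg'), hdis⟩
  obtain ⟨g', hg', hgg'⟩ := (dense_biInter_of_isOpen hGo hP hGd).exists_dist_lt g hε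
  refine ⟨g', fun y => ?_, fun x y hxy => ?_⟩
  · rw [dist_comm]
    exact (ContinuousMap.dist_apply_le_dist y).trans_lt hgg'
  · by_contra hne
    obtain ⟨U, V, hU, hV, hxU, hyV, hUV⟩ := t2_separation hne
    obtain ⟨U', V', hU', hV', hxU', hyV', hUV'⟩ :
        ∃ U' V', U' ∈ 𝓝 x ∧ V' ∈ 𝓝 y ∧ U' ⊆ (chartAt E x).source ∧
          V' ⊆ (chartAt E y).source ∧ Disjoint U' V' :=
      ⟨U ∩ (chartAt E x).source, V ∩ (chartAt E y).source,
        inter_mem (hU.mem_nhds hxU) (chart_source_mem_nhds E x),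
        inter_mem (hV.mem_nhds hyV) (chart_source_mem_nhds E y),
        inter_subset_right, inter_subset_right,
        hUV.mono inter_subset_left inter_subset_left⟩
    obtain ⟨S, ⟨hxS, hSB⟩, hSU⟩ := (hB.nhds_basis_closure x).mem_iff.1 hU'
    obtain ⟨T, ⟨hyT, hTB⟩, hTV⟩ := (hB.nhds_basis_closure y).mem_iff.1 hV'
    have hmem := mem_iInter₂.1 hg' (S, T)
      ⟨⟨hSB, hTB⟩, hUV'.mono hSU hTV, x, y, hSU.trans hxU', hTV.trans hyV'⟩
    exact Set.disjoint_left.1 hmem (mem_image_of_mem _ (subset_closure hxS))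
      (hxy ▸ mem_image_of_mem _ (subset_closure hyT))

open Set Topology Filter Metric in
/-- A continuous map with small fibres has an approximate left inverse followed by a given
isometric embedding into a normed space. -/
lemma IsDeltaMap.exists_dist_comp_lt {X Y : Type} [MetricSpace X] [CompactSpace X]
    [TopologicalSpace Y] [CompactSpace Y] [T2Space Y] {F : Type*} [NormedAddCommGroup F]
    [NormedSpace ℝ F] {δ : ℝ} {f : X → Y} (hf : IsDeltaMap δ f) {i : X → F} (hi : Isometry i) :
    ∃ g : C(Y, F), ∀ x, dist (g (f x)) (i x) < δ := by
  obtain ⟨g, hg⟩ := exists_continuous_forall_mem_convex_of_local_const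
    (t := fun y => ⋂ x ∈ f ⁻¹' {y}, ball (i x) δ)
    (fun y => convex_iInter₂ fun x _ => convex_ball _ _)
    (fun y => by
      obtain ⟨x₀, rfl⟩ := hf.surjective y
      refine ⟨i x₀, ?_⟩
      simp only [mem_iInter₂, mem_ball]
      -- The constant `i x₀` works near `f x₀`: as `f` is closed, nearby fibres lie in any given
      -- neighbourhood of the fibre of `x₀`.
      refine hf.continuous.isClosedMap.eventually_nhds_fiber _ fun x hx => ?_
      refine (isOpen_lt (continuous_const.dist hi.continuous) continuous_const).mem_nhds ?_
      have h : edist x₀ x < ENNReal.ofReal δ :=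
        (edist_le_ediam_of_mem (s := f ⁻¹' {f x₀}) rfl hx).trans_lt (hf.ediam_lt (f x₀))
      rw [edist_dist] at h
      simpa only [mem_ofPred_eq, hi.dist_eq] using (ENNReal.ofReal_lt_ofReal_iff'.1 h).1)
  exact ⟨g, fun x => mem_iInter₂.1 (hg (f x)) x rfl⟩

open Set Topology Filter Metric Module in
/-- A compact metric space in a normed space `F` with `2 * n + 1 ≤ dim F` that is
`n`-manifold-like is approximated by closed orientable `n`-manifolds in `F`. -/
lemma IsManifoldLike.exists_approx {n : ℕ} {X : Type} [MetricSpace X] [CompactSpace X]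
    [Nonempty X] (hX : IsManifoldLike n X) {F : Type} [NormedAddCommGroup F] [NormedSpace ℝ F]
    [FiniteDimensional ℝ F] (hF : 2 * n + 1 ≤ finrank ℝ F) {i : X → F} (hi : Isometry i)
    {δ : ℝ} (hδ : 0 < δ) :
    ∃ (M : Type) (_ : MetricSpace M) (_ : CompactSpace M) (_ : Nonempty M),
      IsClosedTopManifold n M ∧ IsOrientable n M ∧
      (∃ f : X → M, IsDeltaMap δ f) ∧ GromovHausdorff.ghDist X M < δ ∧
      ∃ j : M → F, Isometry j ∧ range j ⊆ thickening δ (range i) := by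
  obtain ⟨M, _, hM, hMo, f, hf⟩ := hX (δ / 3) (by positivity)
  have := hM.compact
  have := hM.t2
  obtain ⟨_⟩ := hM.charted
  obtain ⟨g, hg⟩ := hf.exists_dist_comp_lt hi
  obtain ⟨j, hj, hjinj⟩ := exists_approx_injective (E := EuclideanSpace ℝ (Fin n))
    (by simpa using hF) g (ε := δ / 3) (by positivity)
  have hd : ∀ x, dist (j (f x)) (i x) < 2 * δ / 3 := fun x => by
    linarith [dist_triangle (j (f x)) (g (f x)) (i x), hg x, hj (f x)]
  let _ : MetricSpace M := (j.continuous.isClosedEmbedding hjinj).isEmbedding.comapMetricSpace j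
  have hjiso : Isometry j := (j.continuous.isClosedEmbedding hjinj).isEmbedding.to_isometry
  have hne : Nonempty M := Nonempty.map f ‹_›
  refine ⟨M, inferInstance, hM.compact, hne, hM, hMo, ⟨f, hf.continuous, hf.surjective,
    fun y => (hf.ediam_lt y).trans_le (ENNReal.ofReal_le_ofReal (by linarith))⟩, ?_, j, hjiso, ?_⟩
  · refine (GromovHausdorff.ghDist_le_hausdorffDist hi hjiso).trans_lt
      ((hausdorffDist_le_of_mem_dist (r := 2 * δ / 3) (by positivity) ?_ ?_).trans_lt
        (by linarith))
    · rintro _ ⟨x, rfl⟩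
      exact ⟨_, mem_range_self (f x), by rw [dist_comm]; exact (hd x).le⟩
    · rintro _ ⟨y, rfl⟩
      obtain ⟨x, rfl⟩ := hf.surjective y
      exact ⟨_, mem_range_self x, (hd x).le⟩
  · rintro _ ⟨y, rfl⟩
    obtain ⟨x, rfl⟩ := hf.surjective y
    exact mem_thickening_iff.2 ⟨_, mem_range_self x, (hd x).trans (by linarith)⟩

theorem theorem1p5 (n : ℕ) (hn : 5 ≤ n)
    (X : Type) [MetricSpace X] [CompactSpace X] [Nonempty X]
    (hX : IsOrientableGeneralizedManifold n X) (hlike : IsManifoldLike n X)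
    (m : ℕ) (i : X → EuclideanSpace ℝ (Fin m)) (hi : Isometry i)
    (δ : ℝ) (hδ : 0 < δ) :
    ∃ (M : Type) (_ : MetricSpace M) (_ : CompactSpace M) (_ : Nonempty M),
      IsClosedTopManifold n M ∧ IsOrientable n M ∧
      (∃ f : X → M, IsDeltaMap δ f) ∧
      GromovHausdorff.ghDist X M < δ ∧
      (2 * n + 1 ≤ m → ∃ j : M → EuclideanSpace ℝ (Fin m),
        Isometry j ∧ Set.range j ⊆ Metric.thickening δ (Set.range i)) := by
  by_cases hm : 2 * n + 1 ≤ m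
  · obtain ⟨M, h₁, h₂, h₃, h₄, h₅, h₆, h₇, h₈⟩ :=
      hlike.exists_approx (by simpa using hm) hi hδ
    exact ⟨M, h₁, h₂, h₃, h₄, h₅, h₆, h₇, fun _ => h₈⟩
  -- Zero coordinates make room for general position; the sup metric on the product keeps the map
  -- isometric.
  · have hi' : Isometry fun x => (i x, (0 : EuclideanSpace ℝ (Fin (2 * n + 1)))) :=
      Isometry.of_dist_eq fun x y => by simp [Prod.dist_eq, hi.dist_eq]
    obtain ⟨M, h₁, h₂, h₃, h₄, h₅, h₆, h₇, -⟩ := hlike.exists_approx (by simp) hi' hδ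
    exact ⟨M, h₁, h₂, h₃, h₄, h₅, h₆, h₇, fun h => absurd h hm⟩
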